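/- **Setting.** Let $\mathcal X\subset\mathbb R^k$, let $\mathcal S$ be a non-empty finite set, let $\Phi\subset\mathbb R^d$, and let $f:\mathcal X\times\mathcal S\to\mathbb R^D$, $g:\mathcal X\times\Phi\times\mathcal S\to\mathbb R^J$. Let $\Delta^{D-1}=\{\theta\in\mathbb R^D:\theta\ge 0,\ \sum_i\theta_i=1\}$. Put $\mathcal X(\phi,s)=\{x\in\mathcal X: g(x,\phi,s)\le 0\}$ and $$\mathbf{FOP}(\theta,\phi,s)=\operatorname*{argmax}_{x\in\mathcal X(\phi,s)}\theta^\top f(x,s),$$ $$\ell^{\mathrm{sub},0}(x,\theta,\phi,s)=\max\Bigl(\max_{x'\in\mathcal X(\phi,s)}\theta^\top f(x',s)-\theta^\top f(x,s),\,0\Bigr).$$ **Assumptions.** (i) For all $s\in\mathcal S$ and $\phi\in\Phi$, $f(\cdot,s)$ and $g(\cdot,\phi,s)$ are piecewise linear on $\mathcal X$, and $\mathcal X(\phi,s)$ is a finite union of bounded convex polyhedra. $\mathcal Y(\phi,s)$ denotes the set of vertices of the polyhedra in some presentation of $f(\mathcal X(\phi,s),s)$ as a finite union of bounded convex polyhedra.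 (ii) $\Phi$ is closed under componentwise $\wedge$ and $\vee$, and for all $x\in\mathcal X$, $s\in\mathcal S$ the map $g(x,\cdot,s):\Phi\to\mathbb R^J$ preserves $\wedge$ and $\vee$. (iii) $\mathbb P_{\mathcal S}$ is a probability distribution on $\mathcal S$, and $s^{(1)},\dots,s^{(N)}\in\mathcal S$ are the data, in which every state of $\mathcal S$ occurs at least once. **Algorithm.** Let $\hat x^*:\mathcal S\to\mathcal X$ be the observed solutions. *Stage 1.* Let $\phi^{\sup}$ be the greatest element (componentwise order) of $\{\phi\in\Phi: g(\hat x^*(s),\phi,s)\le 0\ \text{for all } s\in\mathcal S\}$, assumed to exist. *Stage 2.* Let $x^*$ be a solver that returns $x^*(\theta,s)\in\mathbf{FOP}(\theta,\phi^{\sup},s)$ with $f(x^*(\theta,s),s)\in\mathcal Y(\phi^{\sup},s)$ for all $\theta\in\Delta^{D-1}$, $s\in\mathcal S$. Put $F(\theta,s)=f(x^*(\theta,s),s)-f(\hat x^*(s),s)$ and $\bar F(\theta)=\frac1N\sum_{n=1}^N F(\theta,s^{(n)})$. Start from any $\theta^1\in\Delta^{D-1}$; for $i=1,\dots,K-1$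 let $\theta^{i+1}$ be the Euclidean projection onto $\Delta^{D-1}$ of $\theta^i-\alpha_i\bar F(\theta^i)$, with $\alpha_i=i^{-1/2}\|\bar F(\theta^i)\|^{-1}$ (and $\theta^{i+1}=\theta^i$ if $\bar F(\theta^i)=0$). Let $\theta^{\sup}$ be an element of $\{\theta^1,\dots,\theta^K\}$ that minimises $\frac1N\sum_{n=1}^N\ell^{\mathrm{sub},0}(\hat x^*(s^{(n)}),\theta,\phi^{\sup},s^{(n)})$ over this set. **Number of iterations.** For $\theta^{\mathrm{true}}\in\Delta^{D-1}$ let $$G=\frac1N\sum_{n=1}^N\sup_{\xi_1,\xi_2\in f(\mathcal X(\phi^{\sup},s^{(n)}),s^{(n)})}\|\xi_1-\xi_2\|,\qquad \gamma=-\frac1{4NG}\max_{\substack{\theta\in\Delta^{D-1}\\ \bar F(\theta)\ne 0}}\ \sum_{n=1}^N(\theta^{\mathrm{true}})^\top F(\theta,s^{(n)}).$$ Suppose that $K\ge 1$ and $$K\ \ge\ \Bigl(\frac2\gamma\Bigr)^2\Bigl(\frac{\|\theta^1-\theta^{\mathrm{true}}\|^2+\gamma+1}{2}+\log\frac2\gamma\Bigr)^2,$$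 where the second condition is void if $\bar F(\theta)=0$ for every $\theta\in\Delta^{D-1}$. **Theorem.** Let $\phi^{\mathrm{true}}\in\Phi$. Then for almost every $\theta^{\mathrm{true}}\in\Delta^{D-1}$ (with respect to $(D-1)$-dimensional Hausdorff measure) the following holds for every $\hat x^*$ with $\hat x^*(s)\in\mathbf{FOP}(\theta^{\mathrm{true}},\phi^{\mathrm{true}},s)$ for all $s\in\mathcal S$. Every output $(\theta^{\sup},\phi^{\sup})$ of the algorithm, for every such solver, initial point and $K$, satisfies $\mathbb E_{S\sim\mathbb P_{\mathcal S}}\,\ell^{\mathrm{sub},0}(\hat x^*(S),\theta^{\sup},\phi^{\sup},S)\le 0$ (that is, the tolerance $\varepsilon=0$ is met), and $$\hat x^*(s)\in\mathbf{FOP}(\theta^{\sup},\phi^{\sup},s)\qquad\text{for all } s\in\mathcal S.$$ -/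

import Mathlib

open MeasureTheory

noncomputable section

namespace InverseMILP

/-- The probability simplex, as a subset of Euclidean space. -/
def simplex (D : ℕ) : Set (EuclideanSpace ℝ (Fin D)) :=
  {θ | (∀ i, 0 ≤ θ i) ∧ ∑ i, θ i = 1}

/-- The `(D - 1)`-dimensional surface (Hausdorff) measure on the simplex. -/
def simplexMeasure (D : ℕ) : Measure (EuclideanSpace ℝ (Fin D)) :=
  (μH[(D : ℝ) - 1]).restrict (simplex D)

section Polyhedra

variable {E F : Type*} [AddCommGroup E] [Module ℝ E] [AddCommGroup F] [Module ℝ F]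

/-- A convex polyhedron: the solution set of finitely many affine inequalities. -/
def IsPolyhedron (Q : Set E) : Prop :=
  ∃ (m : ℕ) (a : Fin m → E →ₗ[ℝ] ℝ) (b : Fin m → ℝ), Q = {x | ∀ i, a i x ≤ b i}

/-- A bounded convex polyhedron, presented as the convex hull of finitely many points. -/
def IsPolytope (P : Set E) : Prop :=
  ∃ V : Set E, V.Finite ∧ P = convexHull ℝ V

/-- `A` is a finite union of bounded convex polyhedra. -/
def IsPolytopeUnion (A : Set E) : Prop :=
  ∃ C : Set (Set E), C.Finite ∧ (∀ P ∈ C, IsPolytope P) ∧ A = ⋃₀ C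

/-- `Y` is the set of vertices of `A`, for some presentation of `A` as a finite union of bounded
convex polyhedra: the union of the vertex sets of these polyhedra. -/
def IsVertexSet (A Y : Set E) : Prop :=
  ∃ C : Set (Set E), C.Finite ∧ (∀ P ∈ C, IsPolytope P) ∧ A = ⋃₀ C ∧
    Y = ⋃ P ∈ C, Set.extremePoints ℝ P

/-- `h` is piecewise linear (affine) on `X`: finitely many polyhedra cover `X`, and on the part of
`X` inside each of them `h` agrees with an affine map. -/
def PiecewiseLinearOn (h : E → F) (X : Set E) : Prop :=
  ∃ C : Set (Set E), C.Finite ∧ (∀ Q ∈ C, IsPolyhedron Q) ∧ X ⊆ ⋃₀ C ∧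
    ∀ Q ∈ C, ∃ A : E →ᵃ[ℝ] F, Set.EqOn h A (X ∩ Q)

end Polyhedra

/-- `h` is a lattice homomorphism on the sublattice `Φ` of `ℝ^d`. -/
def IsLatticeHomOn {d J : ℕ} (h : (Fin d → ℝ) → (Fin J → ℝ)) (Φ : Set (Fin d → ℝ)) : Prop :=
  ∀ φ₁ ∈ Φ, ∀ φ₂ ∈ Φ, h (φ₁ ⊓ φ₂) = h φ₁ ⊓ h φ₂ ∧ h (φ₁ ⊔ φ₂) = h φ₁ ⊔ h φ₂

/-- The data of a parametric forward problem: maximise `⟪θ, f x s⟫` over `x ∈ X` subject to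
`g x φ s ≤ 0`. Only the values of `f` on `X` and of `g` on `X` and `Φ` matter. -/
structure Forward (k D d J : ℕ) (S : Type*) where
  X : Set (EuclideanSpace ℝ (Fin k))
  Φ : Set (Fin d → ℝ)
  f : EuclideanSpace ℝ (Fin k) → S → EuclideanSpace ℝ (Fin D)
  g : EuclideanSpace ℝ (Fin k) → (Fin d → ℝ) → S → (Fin J → ℝ)

namespace Forward

variable {k D d J N : ℕ} {S : Type*} (p : Forward k D d J S)

/-- The feasible set `X(φ, s)`. -/
def feasible (φ : Fin d → ℝ) (s : S) : Set (EuclideanSpace ℝ (Fin k)) :=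
  {x | x ∈ p.X ∧ p.g x φ s ≤ 0}

/-- The solution set `FOP(θ, φ, s)`. -/
def FOP (θ : EuclideanSpace ℝ (Fin D)) (φ : Fin d → ℝ) (s : S) :
    Set (EuclideanSpace ℝ (Fin k)) :=
  {x | x ∈ p.feasible φ s ∧
    ∀ x' ∈ p.feasible φ s, inner ℝ θ (p.f x' s) ≤ inner ℝ θ (p.f x s)}

/-- The suboptimality loss with penalty weight `lam`. -/
def suboptLoss (lam : ℝ) (x : EuclideanSpace ℝ (Fin k)) (θ : EuclideanSpace ℝ (Fin D))
    (φ : Fin d → ℝ) (s : S) : ℝ :=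
  max (sSup ((fun x' => inner ℝ θ (p.f x' s)) '' p.feasible φ s) - inner ℝ θ (p.f x s)) 0
    + lam * ∑ j, max (p.g x φ s j) 0

/-- The polyhedrality assumption: `f` and `g` are piecewise linear in `x`, and the feasible sets
are finite unions of bounded polyhedra. -/
structure Polyhedral : Prop where
  f_pl : ∀ s, PiecewiseLinearOn (fun x => p.f x s) p.X
  g_pl : ∀ φ ∈ p.Φ, ∀ s, PiecewiseLinearOn (fun x => p.g x φ s) p.X
  feasible_poly : ∀ φ ∈ p.Φ, ∀ s, IsPolytopeUnion (p.feasible φ s)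

/-- The lattice assumption on the constraints. -/
structure LatticeConstraints : Prop where
  sublattice : IsSublattice p.Φ
  hom : ∀ x ∈ p.X, ∀ s, IsLatticeHomOn (fun φ => p.g x φ s) p.Φ

/-- `φsup` is the lattice-supremal constraint parameter that is consistent with all the
observed solutions `xhat s`. -/
def IsPhiSup (xhat : S → EuclideanSpace ℝ (Fin k)) (φsup : Fin d → ℝ) : Prop :=
  IsGreatest {φ | φ ∈ p.Φ ∧ ∀ s, p.g (xhat s) φ s ≤ 0} φsup

/-- `xstar` solves the forward problems with constraint parameter `φ`, for all weights in the
simplex, and the image under `f` of each of its solutions lies in the vertex set `Y φ s`. -/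
def IsVertexSolver (Y : (Fin d → ℝ) → S → Set (EuclideanSpace ℝ (Fin D))) (φ : Fin d → ℝ)
    (xstar : EuclideanSpace ℝ (Fin D) → S → EuclideanSpace ℝ (Fin k)) : Prop :=
  ∀ θ ∈ simplex D, ∀ s, xstar θ s ∈ p.FOP θ φ s ∧ p.f (xstar θ s) s ∈ Y φ s

/-- `F(θ, s) = f(x*(θ, s), s) - f(xhat(s), s)`. -/
def gap (xhat : S → EuclideanSpace ℝ (Fin k))
    (xstar : EuclideanSpace ℝ (Fin D) → S → EuclideanSpace ℝ (Fin k))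
    (θ : EuclideanSpace ℝ (Fin D)) (s : S) : EuclideanSpace ℝ (Fin D) :=
  p.f (xstar θ s) s - p.f (xhat s) s

/-- The subgradient `(1/N) ∑ₙ F(θ, sₙ)` of the empirical suboptimality loss. -/
def meanGap (data : Fin N → S) (xhat : S → EuclideanSpace ℝ (Fin k))
    (xstar : EuclideanSpace ℝ (Fin D) → S → EuclideanSpace ℝ (Fin k))
    (θ : EuclideanSpace ℝ (Fin D)) : EuclideanSpace ℝ (Fin D) :=
  (1 / (N : ℝ)) • ∑ n, p.gap xhat xstar θ (data n)

/-- The empirical suboptimality loss `(1/N) ∑ₙ ℓ^{sub,0}(xhat(sₙ), θ, φ, sₙ)`. -/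
def empiricalLoss (data : Fin N → S) (xhat : S → EuclideanSpace ℝ (Fin k))
    (φ : Fin d → ℝ) (θ : EuclideanSpace ℝ (Fin D)) : ℝ :=
  (1 / (N : ℝ)) * ∑ n, p.suboptLoss 0 (xhat (data n)) θ φ (data n)

/-- `θ 1, …, θ K` are the iterates of projected subgradient descent on the simplex with step size
`k^{-1/2} / ‖subgradient‖`. When the subgradient vanishes the iterate does not move. -/
def IsPSGDRun (data : Fin N → S) (xhat : S → EuclideanSpace ℝ (Fin k))
    (xstar : EuclideanSpace ℝ (Fin D) → S → EuclideanSpace ℝ (Fin k))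
    (K : ℕ) (θ : ℕ → EuclideanSpace ℝ (Fin D)) : Prop :=
  θ 1 ∈ simplex D ∧
  ∀ i, 1 ≤ i → i < K →
    θ (i + 1) ∈ simplex D ∧
    ∀ η ∈ simplex D,
      dist (θ (i + 1)) (θ i - ((i : ℝ) ^ (-(1 / 2) : ℝ) * ‖p.meanGap data xhat xstar (θ i)‖⁻¹) •
          p.meanGap data xhat xstar (θ i)) ≤
      dist η (θ i - ((i : ℝ) ^ (-(1 / 2) : ℝ) * ‖p.meanGap data xhat xstar (θ i)‖⁻¹) •
          p.meanGap data xhat xstar (θ i))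

/-- `θbest` is an iterate among `θ 1, …, θ K` with least empirical suboptimality loss. -/
def IsBestIterate (data : Fin N → S) (xhat : S → EuclideanSpace ℝ (Fin k))
    (φ : Fin d → ℝ) (K : ℕ) (θ : ℕ → EuclideanSpace ℝ (Fin D))
    (θbest : EuclideanSpace ℝ (Fin D)) : Prop :=
  ∃ i, 1 ≤ i ∧ i ≤ K ∧ θbest = θ i ∧
    ∀ j, 1 ≤ j → j ≤ K →
      p.empiricalLoss data xhat φ θbest ≤ p.empiricalLoss data xhat φ (θ j)

/-- The constant `G`: the average diameter of the sets `f(X(φ, sₙ), sₙ)`. -/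
def diamConst (data : Fin N → S) (φ : Fin d → ℝ) : ℝ :=
  (1 / (N : ℝ)) * ∑ n, Metric.diam ((fun x => p.f x (data n)) '' p.feasible φ (data n))

/-- The constant `γ`. If `∑ₙ F(θ, sₙ) = 0` for all `θ` in the simplex, it takes the value `0`. -/
def gammaConst (data : Fin N → S) (xhat : S → EuclideanSpace ℝ (Fin k))
    (xstar : EuclideanSpace ℝ (Fin D) → S → EuclideanSpace ℝ (Fin k))
    (φ : Fin d → ℝ) (θtrue : EuclideanSpace ℝ (Fin D)) : ℝ :=
  -(1 / (4 * (N : ℝ) * p.diamConst data φ)) *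
    sSup ((fun θ => ∑ n, inner ℝ θtrue (p.gap xhat xstar θ (data n))) ''
      {θ | θ ∈ simplex D ∧ ∑ n, p.gap xhat xstar θ (data n) ≠ 0})

/-- `(θsup, φsup)` is an admissible output of the two-stage scheme with tolerance `ε`: first
`φsup` is the supremal consistent constraint parameter, then `θsup` is a weight whose expected
suboptimality loss is at most `ε`. -/
def IsTwoStageOutput [MeasurableSpace S] (P : Measure S) (xhat : S → EuclideanSpace ℝ (Fin k))
    (ε : ℝ) (θsup : EuclideanSpace ℝ (Fin D)) (φsup : Fin d → ℝ) : Prop :=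
  p.IsPhiSup xhat φsup ∧ θsup ∈ simplex D ∧
    ∫ s, p.suboptLoss 0 (xhat s) θsup φsup s ∂P ≤ ε

end Forward

/-- The number of iterations of projected subgradient descent that suffices, in terms of the
constant `γ` and of the squared distance `r` between the initial and the true weight. -/
def iterationBound (γ r : ℝ) : ℝ :=
  (2 / γ) ^ 2 * ((r + γ + 1) / 2 + Real.log (2 / γ)) ^ 2

end InverseMILP

end

/-!
A polytope union is contained in the convex hulls of finitely many points, and almost every weight
separates these points. So for almost every `θtrue` all optimal solutions at `(θtrue, φtrue)` have
the same image under `f`. Since `φtrue ≤ φsup`, passing to `φsup` only shrinks the feasible sets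
and keeps `xhat` feasible: `xhat` is still optimal at `(θtrue, φsup)`, with the same uniqueness.

Consequently `⟪θtrue, F(θ, s)⟫ ≤ 0`, with equality only if `F(θ, s) = 0`. As `F` takes finitely
many values, every nonzero subgradient `v = F̄(θ)` satisfies `⟪v, θ - θtrue⟫ ≥ γ ‖v‖` with `γ > 0`.
A normalized projected step of length `t` then decreases `‖θ - θtrue‖²` by at least `2 γ t - t²`,
which cannot go on for `K` steps of lengths `1, 2^(-1/2), …, K^(-1/2)`. So some iterate has
`F̄(θ) = 0`; there every `F(θ, s)` vanishes, the loss is `0`, and hence it is `0` at the best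
iterate as well.
-/

namespace InverseMILP

section Simplex

theorem hausdorffMeasure_inter_affineSubspace_eq_zero {E : Type*} [NormedAddCommGroup E]
    [NormedSpace ℝ E] [FiniteDimensional ℝ E] [MeasurableSpace E] [BorelSpace E]
    {s : Set E} {B : AffineSubspace ℝ E} (hsB : ¬ s ⊆ B) {d : ℝ}
    (hd : Module.finrank ℝ (vectorSpan ℝ s) ≤ d) : μH[d] (s ∩ B) = 0 := by
  have hlt : affineSpan ℝ s ⊓ B < affineSpan ℝ s :=
    inf_le_left.lt_of_not_ge fun h => hsB ((subset_affineSpan ℝ s).trans (h.trans inf_le_right))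
  have hsub : s ∩ B ⊆ ((affineSpan ℝ s ⊓ B : AffineSubspace ℝ E) : Set E) :=
    Set.inter_subset_inter_left _ (subset_affineSpan ℝ s)
  refine measure_mono_null hsub ?_
  rcases ((affineSpan ℝ s ⊓ B : AffineSubspace ℝ E) : Set E).eq_empty_or_nonempty with h | hne
  · rw [h, measure_empty]
  lift d to NNReal using (Nat.cast_nonneg _).trans hd
  have hfinrank :=
    Submodule.finrank_lt_finrank_of_lt (AffineSubspace.direction_lt_of_nonempty hlt hne)
  rw [direction_affineSpan] at hfinrank
  refine hausdorffMeasure_of_dimH_lt ?_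
  rw [Real.Convex.dimH_eq_finrank_vectorSpan (AffineSubspace.convex _) hne]
  exact_mod_cast (Nat.cast_lt.2 hfinrank).trans_le hd

variable {D : ℕ}

theorem isClosed_simplex : IsClosed (simplex D) :=
  (isClosed_stdSimplex ℝ (Fin D)).preimage (PiLp.continuous_ofLp 2 _)

theorem convex_simplex : Convex ℝ (simplex D) :=
  (convex_stdSimplex ℝ (Fin D)).linear_preimage
    (WithLp.linearEquiv 2 ℝ (Fin D → ℝ)).toLinearMap

theorem single_mem_simplex (i : Fin D) : EuclideanSpace.single i 1 ∈ simplex D :=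
  single_mem_stdSimplex ℝ i

theorem finrank_vectorSpan_simplex_lt (hD : D ≠ 0) :
    Module.finrank ℝ (vectorSpan ℝ (simplex D)) < D := by
  let coordSum : EuclideanSpace ℝ (Fin D) →ₗ[ℝ] ℝ := ∑ i, (EuclideanSpace.proj i).toLinearMap
  have hle : vectorSpan ℝ (simplex D) ≤ coordSum.ker := by
    refine Submodule.span_le.2 ?_
    rintro _ ⟨x, hx, y, hy, rfl⟩
    simp [coordSum, hx.2, hy.2]
  have hker : coordSum.ker ≠ ⊤ := fun h => by
    have := LinearMap.congr_fun (LinearMap.ker_eq_top.1 h)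
      (EuclideanSpace.single ⟨0, Nat.pos_of_ne_zero hD⟩ 1)
    simp [coordSum] at this
  simpa using (Submodule.finrank_mono hle).trans_lt (Submodule.finrank_lt hker)

theorem simplexMeasure_hyperplane_eq_zero {u : EuclideanSpace ℝ (Fin D)} (hu : u ≠ 0) :
    simplexMeasure D {θ | inner ℝ θ u = 0} = 0 := by
  have hmeas : MeasurableSet {θ : EuclideanSpace ℝ (Fin D) | inner ℝ θ u = 0} :=
    (isClosed_eq (by fun_prop) continuous_const).measurableSet
  have hD : D ≠ 0 := by
    rintro rfl
    exact hu (Subsingleton.elim _ _)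
  have hvertices : ¬ simplex D ⊆ ((ℝ ∙ u)ᗮ.toAffineSubspace : Set (EuclideanSpace ℝ (Fin D))) := by
    intro h
    refine hu (PiLp.ext fun i => ?_)
    simpa [Submodule.mem_orthogonal_singleton_iff_inner_left, EuclideanSpace.inner_single_left]
      using h (single_mem_simplex i)
  rw [simplexMeasure, Measure.restrict_apply hmeas, Set.inter_comm]
  convert hausdorffMeasure_inter_affineSubspace_eq_zero hvertices (d := D - 1) ?_ using 3
  · ext θ
    simp [Submodule.mem_orthogonal_singleton_iff_inner_left]
  · rw [le_sub_iff_add_le]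
    exact_mod_cast finrank_vectorSpan_simplex_lt hD

theorem ae_injOn_inner {W : Set (EuclideanSpace ℝ (Fin D))} (hW : W.Countable) :
    ∀ᵐ θ ∂(simplexMeasure D), Set.InjOn (innerₗ (EuclideanSpace ℝ (Fin D)) θ) W := by
  have hpair : ∀ v w : EuclideanSpace ℝ (Fin D),
      ∀ᵐ θ ∂(simplexMeasure D), inner ℝ θ v = inner ℝ θ w → v = w := by
    intro v w
    by_cases hvw : v = w
    · exact ae_of_all _ fun _ _ => hvw
    filter_upwards [measure_eq_zero_iff_ae_notMem.1
      (simplexMeasure_hyperplane_eq_zero (sub_ne_zero.2 hvw))] with θ hθ h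
    exact absurd (by simp [inner_sub_right, h]) hθ
  have hW' : ∀ᵐ θ ∂(simplexMeasure D), ∀ v ∈ W, ∀ w ∈ W, inner ℝ θ v = inner ℝ θ w → v = w :=
    (ae_ball_iff hW).2 fun v _ => (ae_ball_iff hW).2 fun w _ => hpair v w
  filter_upwards [hW'] with θ hθ v hv w hw h using hθ v hv w hw h

end Simplex

section Polytopes

variable {E : Type*} [AddCommGroup E] [Module ℝ E]

theorem mem_of_mem_convexHull_of_injOn {V : Set E} {l : E →ₗ[ℝ] ℝ} (hinj : Set.InjOn l V)
    {x : E} (hx : x ∈ convexHull ℝ V) (hmax : ∀ v ∈ V, l v ≤ l x) : x ∈ V := by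
  obtain ⟨ι, _, w, z, hw0, hw1, hz, hwz⟩ := mem_convexHull_iff_exists_fintype.1 hx
  have hsum : ∑ i, w i * (l x - l (z i)) = 0 := by
    simp [mul_sub, ← Finset.sum_mul, hw1, ← hwz]
  have hface : ∀ i, w i ≠ 0 → l (z i) = l x := by
    intro i hi
    have hterm := (Finset.sum_eq_zero_iff_of_nonneg fun i _ =>
      mul_nonneg (hw0 i) (sub_nonneg.2 (hmax _ (hz i)))).1 hsum i (Finset.mem_univ i)
    exact (sub_eq_zero.1 ((mul_eq_zero_iff_left hi).1 hterm)).symm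
  obtain ⟨i₀, -, hi₀⟩ := Finset.exists_ne_zero_of_sum_ne_zero (hw1.trans_ne one_ne_zero)
  have hconst : ∀ i, w i • z i = w i • z i₀ := by
    intro i
    by_cases hi : w i = 0
    · simp [hi]
    · rw [hinj (hz i) (hz i₀) ((hface i hi).trans (hface i₀ hi₀).symm)]
  rw [← hwz, Finset.sum_congr rfl fun i _ => hconst i, ← Finset.sum_smul, hw1, one_smul]
  exact hz i₀

theorem IsPolytopeUnion.exists_finite_subsingleton_setOf_isMaxOn {A : Set E}
    (hA : IsPolytopeUnion A) :
    ∃ W : Set E, W.Finite ∧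
      ∀ l : E →ₗ[ℝ] ℝ, Set.InjOn l W → {x ∈ A | IsMaxOn l A x}.Subsingleton := by
  obtain ⟨C, hC, hP, rfl⟩ := hA
  choose! V hV hPV using hP
  refine ⟨⋃ P ∈ C, V P, hC.biUnion hV, fun l hinj => ?_⟩
  have hmem : ∀ x ∈ ⋃₀ C, IsMaxOn l (⋃₀ C) x → x ∈ ⋃ P ∈ C, V P := by
    rintro x ⟨P, hPC, hxP⟩ hx
    have hVP : V P ⊆ P := (subset_convexHull ℝ _).trans (hPV P hPC).ge
    have hVC : V P ⊆ ⋃ P ∈ C, V P := Set.subset_biUnion_of_mem hPC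
    exact hVC (mem_of_mem_convexHull_of_injOn (hinj.mono hVC) (hPV P hPC ▸ hxP)
      fun v hv => hx ⟨P, hPC, hVP hv⟩)
  rintro x ⟨hxA, hx⟩ y ⟨hyA, hy⟩
  exact hinj (hmem x hxA hx) (hmem y hyA hy) (le_antisymm (hy hxA) (hx hyA))

theorem IsVertexSet.isPolytopeUnion {A Y : Set E} (h : IsVertexSet A Y) : IsPolytopeUnion A := by
  obtain ⟨C, hC, hP, hA, -⟩ := h
  exact ⟨C, hC, hP, hA⟩

theorem IsVertexSet.finite {A Y : Set E} (h : IsVertexSet A Y) : Y.Finite := by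
  obtain ⟨C, hC, hP, -, rfl⟩ := h
  refine hC.biUnion fun P hPC => ?_
  obtain ⟨V, hV, rfl⟩ := hP P hPC
  exact hV.subset extremePoints_convexHull_subset

theorem IsPolytopeUnion.isBounded {E : Type*} [NormedAddCommGroup E] [NormedSpace ℝ E] {A : Set E}
    (hA : IsPolytopeUnion A) : Bornology.IsBounded A := by
  obtain ⟨C, hC, hP, rfl⟩ := hA
  refine (Bornology.isBounded_sUnion hC).2 fun P hPC => ?_
  obtain ⟨V, hV, rfl⟩ := hP P hPC
  exact isBounded_convexHull.2 hV.isBounded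

theorem ae_subsingleton_setOf_isMaxOn_inner {D : ℕ} {A : Set (EuclideanSpace ℝ (Fin D))}
    (hA : IsPolytopeUnion A) :
    ∀ᵐ θ ∂(simplexMeasure D), {y ∈ A | IsMaxOn (inner ℝ θ) A y}.Subsingleton := by
  obtain ⟨W, hW, hunique⟩ := hA.exists_finite_subsingleton_setOf_isMaxOn
  filter_upwards [ae_injOn_inner hW.countable] with θ hθ using hunique _ hθ

end Polytopes

section Descent

variable {E : Type*} [NormedAddCommGroup E] [InnerProductSpace ℝ E]

theorem norm_sub_le_of_forall_dist_le {C : Set E} (hC : Convex ℝ C) {x y η : E}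
    (hx : x ∈ C) (hη : η ∈ C) (hmin : ∀ z ∈ C, dist x y ≤ dist z y) : ‖x - η‖ ≤ ‖y - η‖ := by
  have hinf : ‖y - x‖ = ⨅ w : C, ‖y - w‖ := by
    have : Nonempty C := ⟨⟨x, hx⟩⟩
    refine le_antisymm (le_ciInf fun w => ?_) (ciInf_le ⟨0, ?_⟩ (⟨x, hx⟩ : C))
    · simpa only [dist_eq_norm, norm_sub_rev] using hmin w w.2
    · rintro _ ⟨w, rfl⟩
      exact norm_nonneg _
  have hobtuse : inner ℝ (y - x) (η - x) ≤ 0 :=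
    (norm_eq_iInf_iff_real_inner_le_zero hC hx).1 hinf η hη
  have hexpand : ‖y - η‖ ^ 2 = ‖y - x‖ ^ 2 - 2 * inner ℝ (y - x) (η - x) + ‖x - η‖ ^ 2 := by
    rw [← sub_sub_sub_cancel_right y η x, norm_sub_sq_real, norm_sub_rev η x]
  exact le_of_sq_le_sq (by nlinarith [sq_nonneg ‖y - x‖]) (norm_nonneg _)

theorem norm_sub_smul_sub_sq_le {θ η v : E} {t c : ℝ} (ht : 0 ≤ t) (hv : v ≠ 0)
    (h : c * ‖v‖ ≤ inner ℝ v (θ - η)) :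
    ‖θ - (t * ‖v‖⁻¹) • v - η‖ ^ 2 ≤ ‖θ - η‖ ^ 2 - (2 * c * t - t ^ 2) := by
  have hv' : 0 < ‖v‖ := norm_pos_iff.2 hv
  have hnorm : ‖(t * ‖v‖⁻¹) • v‖ = t := by
    rw [norm_smul, Real.norm_of_nonneg (by positivity), inv_mul_cancel_right₀ hv'.ne']
  have hinner : c * t ≤ inner ℝ (θ - η) ((t * ‖v‖⁻¹) • v) := by
    rw [inner_smul_right, real_inner_comm, mul_assoc, mul_comm c, inv_mul_eq_div]
    exact mul_le_mul_of_nonneg_left ((le_div_iff₀ hv').2 h) ht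
  rw [sub_right_comm, norm_sub_sq_real, hnorm]
  linarith

theorem sum_Icc_le_of_forall_add_le {a δ : ℕ → ℝ} {K : ℕ} (hK : 1 ≤ K)
    (hstep : ∀ i, 1 ≤ i → i < K → δ i + a (i + 1) ≤ a i) (hlast : δ K ≤ a K) :
    ∑ i ∈ Finset.Icc 1 K, δ i ≤ a 1 := by
  have htelescope : ∀ m, 1 ≤ m → m ≤ K → ∑ i ∈ Finset.Ico 1 m, δ i + a m ≤ a 1 := by
    intro m hm
    induction m, hm using Nat.le_induction with
    | base => simp
    | succ m hm ih =>
      intro hmK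
      rw [Finset.sum_Ico_succ_top hm]
      linarith [ih (by omega), hstep m hm hmK]
  rw [← Finset.Ico_add_one_right_eq_Icc, Finset.sum_Ico_succ_top hK]
  linarith [htelescope K hK le_rfl]

theorem sqrt_le_sum_rpow_neg_half (K : ℕ) :
    √K ≤ ∑ i ∈ Finset.Icc 1 K, (i : ℝ) ^ (-(1 / 2) : ℝ) := by
  have hterm : ∀ i ∈ Finset.Icc 1 K, (√K)⁻¹ ≤ (i : ℝ) ^ (-(1 / 2) : ℝ) := by
    intro i hi
    obtain ⟨hi1, hiK⟩ := Finset.mem_Icc.1 hi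
    rw [Real.rpow_neg (by positivity), ← Real.sqrt_eq_rpow]
    gcongr
  calc √K = (Finset.Icc 1 K).card • (√K)⁻¹ := by
        rw [Nat.card_Icc, Nat.add_sub_cancel, nsmul_eq_mul, ← div_eq_mul_inv, Real.div_sqrt]
    _ ≤ _ := Finset.card_nsmul_le_sum _ _ _ hterm

theorem sum_rpow_neg_half_sq_le (K : ℕ) :
    ∑ i ∈ Finset.Icc 1 K, ((i : ℝ) ^ (-(1 / 2) : ℝ)) ^ 2 ≤ 1 + Real.log K := by
  have hsq : ∀ i : ℕ, ((i : ℝ) ^ (-(1 / 2) : ℝ)) ^ 2 = (i : ℝ)⁻¹ := fun i => by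
    rw [← Real.rpow_natCast, ← Real.rpow_mul (by positivity)]
    norm_num [Real.rpow_neg_one]
  simpa only [hsq, harmonic_eq_sum_Icc, Rat.cast_sum, Rat.cast_inv, Rat.cast_natCast]
    using harmonic_le_one_add_log K

theorem lt_of_iterationBound_le {γ r : ℝ} {K : ℕ} (hγ : 0 < γ) (hK1 : 1 ≤ K)
    (hK : iterationBound γ r ≤ K) : r + 1 + Real.log K < 2 * γ * √K := by
  have hKpos : (0 : ℝ) < K := by exact_mod_cast hK1
  have hscaled : 0 < γ * √K / 2 := half_pos (mul_pos hγ (Real.sqrt_pos.2 hKpos))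
  have hbound : r + γ + 1 + 2 * Real.log (2 / γ) ≤ γ * √K := by
    have hle : 2 / γ * ((r + γ + 1) / 2 + Real.log (2 / γ)) ≤ √K :=
      Real.le_sqrt_of_sq_le (by rwa [mul_pow])
    have := mul_le_mul_of_nonneg_left hle hγ.le
    field_simp at this
    linarith
  have hlog : Real.log K = 2 * (Real.log (γ * √K / 2) + Real.log (2 / γ)) := by
    rw [← Real.log_mul hscaled.ne' (by positivity), div_mul_div_comm, mul_comm 2 γ,
      mul_div_mul_right _ _ two_ne_zero, mul_div_cancel_left₀ _ hγ.ne', Real.log_sqrt hKpos.le]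
    ring
  -- The bound `log x ≤ x - 1` at `x = γ √K / 2` absorbs `log K` into `γ √K`.
  linarith [Real.log_le_sub_one_of_pos hscaled]

theorem two_mul_sqrt_le_of_normalized_descent {C : Set E} (hC : Convex ℝ C) {θ v : ℕ → E} {η : E}
    (hη : η ∈ C) {c : ℝ} (hc : 0 ≤ c) {K : ℕ} (hK : 1 ≤ K)
    (hmem : ∀ i, 1 ≤ i → i < K → θ (i + 1) ∈ C)
    (hproj : ∀ i, 1 ≤ i → i < K → ∀ z ∈ C,
      dist (θ (i + 1)) (θ i - ((i : ℝ) ^ (-(1 / 2) : ℝ) * ‖v i‖⁻¹) • v i) ≤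
        dist z (θ i - ((i : ℝ) ^ (-(1 / 2) : ℝ) * ‖v i‖⁻¹) • v i))
    (hne : ∀ i, 1 ≤ i → i ≤ K → v i ≠ 0)
    (hsharp : ∀ i, 1 ≤ i → i ≤ K → c * ‖v i‖ ≤ inner ℝ (v i) (θ i - η)) :
    2 * c * √K ≤ ‖θ 1 - η‖ ^ 2 + 1 + Real.log K := by
  set t : ℕ → ℝ := fun i => (i : ℝ) ^ (-(1 / 2) : ℝ)
  have hstep : ∀ i, 1 ≤ i → i ≤ K → ‖θ i - (t i * ‖v i‖⁻¹) • v i - η‖ ^ 2 ≤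
      ‖θ i - η‖ ^ 2 - (2 * c * t i - t i ^ 2) := fun i hi hiK =>
    norm_sub_smul_sub_sq_le (by positivity) (hne i hi hiK) (hsharp i hi hiK)
  have hsum : ∑ i ∈ Finset.Icc 1 K, (2 * c * t i - t i ^ 2) ≤ ‖θ 1 - η‖ ^ 2 := by
    refine sum_Icc_le_of_forall_add_le (a := fun i => ‖θ i - η‖ ^ 2) hK (fun i hi hiK => ?_) ?_
    · have hcontract := pow_le_pow_left₀ (norm_nonneg _)
        (norm_sub_le_of_forall_dist_le hC (hmem i hi hiK) hη (hproj i hi hiK)) 2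
      linarith [hstep i hi hiK.le]
    · linarith [hstep K hK le_rfl, sq_nonneg ‖θ K - (t K * ‖v K‖⁻¹) • v K - η‖]
  rw [Finset.sum_sub_distrib, ← Finset.mul_sum] at hsum
  linarith [mul_le_mul_of_nonneg_left (sqrt_le_sum_rpow_neg_half K) (by positivity : 0 ≤ 2 * c),
    sum_rpow_neg_half_sq_le K]

end Descent

theorem IsLatticeHomOn.monotoneOn {d J : ℕ} {h : (Fin d → ℝ) → (Fin J → ℝ)}
    {Φ : Set (Fin d → ℝ)} (hh : IsLatticeHomOn h Φ) : MonotoneOn h Φ := by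
  intro φ₁ hφ₁ φ₂ hφ₂ hle
  have hsup := (hh φ₁ hφ₁ φ₂ hφ₂).2
  rw [sup_eq_right.2 hle] at hsup
  exact sup_eq_right.1 hsup.symm

namespace Forward

variable {k D d J N : ℕ} {S : Type*} {p : Forward k D d J S} {s : S}
  {φ φ₁ φ₂ φsup : Fin d → ℝ} {θ η : EuclideanSpace ℝ (Fin D)}
  {x : EuclideanSpace ℝ (Fin k)} {xhat : S → EuclideanSpace ℝ (Fin k)}
  {xstar : EuclideanSpace ℝ (Fin D) → S → EuclideanSpace ℝ (Fin k)} {data : Fin N → S}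
  {Y : (Fin d → ℝ) → S → Set (EuclideanSpace ℝ (Fin D))}

theorem feasible_antitoneOn (hg : ∀ x ∈ p.X, MonotoneOn (fun φ => p.g x φ s) p.Φ) :
    AntitoneOn (fun φ => p.feasible φ s) p.Φ :=
  fun _ hφ₁ _ hφ₂ hle _ hx => ⟨hx.1, (hg _ hx.1 hφ₁ hφ₂ hle).trans hx.2⟩

theorem IsPhiSup.feasible_subset (hsup : p.IsPhiSup xhat φsup)
    (hg : ∀ x ∈ p.X, ∀ s, MonotoneOn (fun φ => p.g x φ s) p.Φ) (hφ : φ ∈ p.Φ)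
    (hxhat : ∀ s, xhat s ∈ p.feasible φ s) (s : S) : p.feasible φsup s ⊆ p.feasible φ s :=
  feasible_antitoneOn (fun x hx => hg x hx s) hφ hsup.1.1 (hsup.2 ⟨hφ, fun s => (hxhat s).2⟩)

variable (p) in
/-- The observed solutions `xhat` are optimal for the weight `η` and the constraint parameter `φ`,
and in every state all optimal solutions have the same image under `f`. -/
def IsStrictlyOptimal (η : EuclideanSpace ℝ (Fin D)) (φ : Fin d → ℝ)
    (xhat : S → EuclideanSpace ℝ (Fin k)) : Prop :=
  ∀ s, xhat s ∈ p.feasible φ s ∧ ∀ x ∈ p.feasible φ s, p.f x s ≠ p.f (xhat s) s →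
    inner ℝ η (p.f x s) < inner ℝ η (p.f (xhat s) s)

theorem ae_isStrictlyOptimal [Countable S]
    (hA : ∀ s, IsPolytopeUnion ((fun x => p.f x s) '' p.feasible φ s)) :
    ∀ᵐ η ∂(simplexMeasure D), ∀ xhat : S → EuclideanSpace ℝ (Fin k),
      (∀ s, xhat s ∈ p.FOP η φ s) → p.IsStrictlyOptimal η φ xhat := by
  filter_upwards [ae_all_iff.2 fun s => ae_subsingleton_setOf_isMaxOn_inner (hA s)]
    with η hunique xhat hxhat s
  have hmax : IsMaxOn (inner ℝ η) ((fun x => p.f x s) '' p.feasible φ s) (p.f (xhat s) s) :=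
    isMaxOn_iff.2 (Set.forall_mem_image.2 (hxhat s).2)
  refine ⟨(hxhat s).1, fun x hx hne => ((hxhat s).2 x hx).lt_of_ne fun heq => hne ?_⟩
  refine hunique s ⟨⟨x, hx, rfl⟩, isMaxOn_iff.2 fun y hy => ?_⟩ ⟨⟨_, (hxhat s).1, rfl⟩, hmax⟩
  exact (isMaxOn_iff.1 hmax y hy).trans_eq heq.symm

namespace IsStrictlyOptimal

theorem anti (h : p.IsStrictlyOptimal η φ₁ xhat) (hsub : ∀ s, p.feasible φ₂ s ⊆ p.feasible φ₁ s)
    (hxhat : ∀ s, xhat s ∈ p.feasible φ₂ s) : p.IsStrictlyOptimal η φ₂ xhat :=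
  fun s => ⟨hxhat s, fun x hx => (h s).2 x (hsub s hx)⟩

theorem inner_gap_neg (h : p.IsStrictlyOptimal η φ xhat) (hfeas : xstar θ s ∈ p.feasible φ s)
    (hgap : p.gap xhat xstar θ s ≠ 0) : inner ℝ η (p.gap xhat xstar θ s) < 0 := by
  rw [gap, inner_sub_right, sub_neg]
  exact (h s).2 _ hfeas (sub_ne_zero.1 hgap)

theorem inner_gap_nonpos (h : p.IsStrictlyOptimal η φ xhat)
    (hfeas : xstar θ s ∈ p.feasible φ s) : inner ℝ η (p.gap xhat xstar θ s) ≤ 0 := by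
  by_cases hgap : p.gap xhat xstar θ s = 0
  · rw [hgap, inner_zero_right]
  · exact (h.inner_gap_neg hfeas hgap).le

theorem sum_inner_gap_neg (h : p.IsStrictlyOptimal η φ xhat)
    (hfeas : ∀ s, xstar θ s ∈ p.feasible φ s) {n : Fin N}
    (hgap : p.gap xhat xstar θ (data n) ≠ 0) :
    ∑ n, inner ℝ η (p.gap xhat xstar θ (data n)) < 0 :=
  Finset.sum_neg' (fun _ _ => h.inner_gap_nonpos (hfeas _))
    ⟨n, Finset.mem_univ n, h.inner_gap_neg (hfeas _) hgap⟩

end IsStrictlyOptimal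

theorem inner_gap_nonneg (hstar : xstar θ s ∈ p.FOP θ φ s) (hxhat : xhat s ∈ p.feasible φ s) :
    0 ≤ inner ℝ θ (p.gap xhat xstar θ s) := by
  rw [gap, inner_sub_right]
  exact sub_nonneg.2 (hstar.2 _ hxhat)

theorem mem_FOP_of_gap_eq_zero (hstar : xstar θ s ∈ p.FOP θ φ s)
    (hxhat : xhat s ∈ p.feasible φ s) (hgap : p.gap xhat xstar θ s = 0) :
    xhat s ∈ p.FOP θ φ s :=
  ⟨hxhat, fun x hx => sub_eq_zero.1 hgap ▸ hstar.2 x hx⟩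

theorem meanGap_eq_zero_iff :
    p.meanGap data xhat xstar θ = 0 ↔ ∑ n, p.gap xhat xstar θ (data n) = 0 := by
  rcases eq_or_ne N 0 with rfl | hN
  · simp [meanGap]
  · simp [meanGap, hN]

theorem inner_meanGap : inner ℝ η (p.meanGap data xhat xstar θ) =
    (1 / (N : ℝ)) * ∑ n, inner ℝ η (p.gap xhat xstar θ (data n)) := by
  rw [meanGap, inner_smul_right, inner_sum]

theorem IsStrictlyOptimal.gap_eq_zero_of_meanGap_eq_zero (h : p.IsStrictlyOptimal η φ xhat)
    (hfeas : ∀ s, xstar θ s ∈ p.feasible φ s) (hmean : p.meanGap data xhat xstar θ = 0)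
    (n : Fin N) : p.gap xhat xstar θ (data n) = 0 := by
  by_contra hgap
  refine (h.sum_inner_gap_neg hfeas hgap).ne ?_
  rw [← inner_sum, meanGap_eq_zero_iff.1 hmean, inner_zero_right]

theorem IsStrictlyOptimal.sum_inner_gap_neg_of_sum_gap_ne_zero (h : p.IsStrictlyOptimal η φ xhat)
    (hfeas : ∀ s, xstar θ s ∈ p.feasible φ s) (hsum : ∑ n, p.gap xhat xstar θ (data n) ≠ 0) :
    ∑ n, inner ℝ η (p.gap xhat xstar θ (data n)) < 0 := by
  obtain ⟨n, -, hgap⟩ := Finset.exists_ne_zero_of_sum_ne_zero hsum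
  exact h.sum_inner_gap_neg hfeas hgap

theorem norm_meanGap_le_diamConst
    (hbdd : ∀ s, Bornology.IsBounded ((fun x => p.f x s) '' p.feasible φ s))
    (hfeas : ∀ s, xstar θ s ∈ p.feasible φ s) (hxhat : ∀ s, xhat s ∈ p.feasible φ s) :
    ‖p.meanGap data xhat xstar θ‖ ≤ p.diamConst data φ := by
  rw [meanGap, diamConst, norm_smul, Real.norm_of_nonneg (by positivity)]
  refine mul_le_mul_of_nonneg_left (norm_sum_le_of_le _ fun n _ => ?_) (by positivity)
  rw [gap, ← dist_eq_norm]
  exact Metric.dist_le_diam_of_mem (hbdd _) ⟨_, hfeas _, rfl⟩ ⟨_, hxhat _, rfl⟩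

theorem IsVertexSolver.finite_image_sum_inner_gap (hstar : p.IsVertexSolver Y φ xstar)
    (hY : ∀ s, (Y φ s).Finite) {T : Set (EuclideanSpace ℝ (Fin D))} (hT : T ⊆ simplex D) :
    ((fun θ => ∑ n, inner ℝ η (p.gap xhat xstar θ (data n))) '' T).Finite := by
  have hvertices : {y : Fin N → EuclideanSpace ℝ (Fin D) | ∀ n, y n ∈ Y φ (data n)}.Finite :=
    Set.Finite.pi' fun n => hY (data n)
  refine (hvertices.image fun y => ∑ n, inner ℝ η (y n - p.f (xhat (data n)) (data n))).subset ?_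
  rintro _ ⟨θ, hθ, rfl⟩
  exact ⟨fun n => p.f (xstar θ (data n)) (data n), fun n => (hstar θ (hT hθ) _).2, rfl⟩

theorem gammaConst_pos (hη : p.IsStrictlyOptimal η φ xhat) (hstar : p.IsVertexSolver Y φ xstar)
    (hY : ∀ s, (Y φ s).Finite)
    (hbdd : ∀ s, Bornology.IsBounded ((fun x => p.f x s) '' p.feasible φ s))
    (hθ : θ ∈ simplex D) (hmean : p.meanGap data xhat xstar θ ≠ 0) :
    0 < p.gammaConst data xhat xstar φ η := by
  have hfeas : ∀ θ ∈ simplex D, ∀ s, xstar θ s ∈ p.feasible φ s := fun θ hθ s => (hstar θ hθ s).1.1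
  have hG : 0 < p.diamConst data φ := (norm_pos_iff.2 hmean).trans_le
    (norm_meanGap_le_diamConst hbdd (hfeas θ hθ) fun s => (hη s).1)
  have hN : 0 < (N : ℝ) := by
    rw [Nat.cast_pos, Nat.pos_iff_ne_zero]
    rintro rfl
    exact hmean (meanGap_eq_zero_iff.2 (Fin.sum_univ_zero _))
  set T := (fun θ => ∑ n, inner ℝ η (p.gap xhat xstar θ (data n))) ''
    {θ | θ ∈ simplex D ∧ ∑ n, p.gap xhat xstar θ (data n) ≠ 0} with hT
  have hmax : sSup T ∈ T := Set.Nonempty.csSup_mem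
    ⟨_, θ, ⟨hθ, meanGap_eq_zero_iff.not.1 hmean⟩, rfl⟩
    (hstar.finite_image_sum_inner_gap hY fun _ h => h.1)
  have hneg : ∀ t ∈ T, t < 0 := Set.forall_mem_image.2 fun θ h =>
    hη.sum_inner_gap_neg_of_sum_gap_ne_zero (hfeas θ h.1) h.2
  rw [gammaConst, ← hT, neg_mul, neg_pos]
  exact mul_neg_of_pos_of_neg (by positivity) (hneg _ hmax)

theorem gammaConst_le (hstar : p.IsVertexSolver Y φ xstar) (hY : ∀ s, (Y φ s).Finite)
    (hθ : θ ∈ simplex D) (hmean : p.meanGap data xhat xstar θ ≠ 0) :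
    p.gammaConst data xhat xstar φ η ≤
      -inner ℝ η (p.meanGap data xhat xstar θ) / (4 * p.diamConst data φ) := by
  have hG : 0 ≤ p.diamConst data φ :=
    mul_nonneg (by positivity) (Finset.sum_nonneg fun _ _ => Metric.diam_nonneg)
  have hfin := hstar.finite_image_sum_inner_gap (data := data) (xhat := xhat) (η := η) hY
    (T := {θ | θ ∈ simplex D ∧ ∑ n, p.gap xhat xstar θ (data n) ≠ 0}) fun _ h => h.1
  have hle := le_csSup hfin.bddAbove ⟨θ, ⟨hθ, meanGap_eq_zero_iff.not.1 hmean⟩, rfl⟩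
  rw [gammaConst, neg_mul]
  refine (neg_le_neg (mul_le_mul_of_nonneg_left hle (by positivity))).trans_eq ?_
  rw [inner_meanGap]
  ring

theorem gammaConst_mul_norm_meanGap_le (hη : p.IsStrictlyOptimal η φ xhat)
    (hstar : p.IsVertexSolver Y φ xstar) (hY : ∀ s, (Y φ s).Finite)
    (hbdd : ∀ s, Bornology.IsBounded ((fun x => p.f x s) '' p.feasible φ s))
    (hθ : θ ∈ simplex D) (hmean : p.meanGap data xhat xstar θ ≠ 0) :
    p.gammaConst data xhat xstar φ η * ‖p.meanGap data xhat xstar θ‖ ≤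
      inner ℝ (p.meanGap data xhat xstar θ) (θ - η) := by
  set m := p.meanGap data xhat xstar θ with hm
  have hfeas : ∀ s, xstar θ s ∈ p.feasible φ s := fun s => (hstar θ hθ s).1.1
  have hG : ‖m‖ ≤ p.diamConst data φ := norm_meanGap_le_diamConst hbdd hfeas fun s => (hη s).1
  have hnorm : 0 < ‖m‖ := norm_pos_iff.2 hmean
  have hη_nonpos : inner ℝ η m ≤ 0 := by
    rw [hm, inner_meanGap]
    exact mul_nonpos_of_nonneg_of_nonpos (by positivity)
      (Finset.sum_nonpos fun _ _ => hη.inner_gap_nonpos (hfeas _))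
  have hθ_nonneg : 0 ≤ inner ℝ θ m := by
    rw [hm, inner_meanGap]
    exact mul_nonneg (by positivity)
      (Finset.sum_nonneg fun _ _ => inner_gap_nonneg (hstar θ hθ _).1 (hη _).1)
  calc p.gammaConst data xhat xstar φ η * ‖m‖
      ≤ -inner ℝ η m / (4 * p.diamConst data φ) * ‖m‖ := by
        gcongr
        exact gammaConst_le hstar hY hθ hmean
    _ ≤ -inner ℝ η m := by
        rw [div_mul_eq_mul_div, div_le_iff₀ (by linarith)]
        exact mul_le_mul_of_nonneg_left (by linarith) (neg_nonneg.2 hη_nonpos)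
    _ ≤ inner ℝ m (θ - η) := by
        rw [inner_sub_right, real_inner_comm θ m, real_inner_comm η m]
        linarith

theorem suboptLoss_zero_nonneg : 0 ≤ p.suboptLoss 0 x θ φ s := by
  simp [suboptLoss]

theorem suboptLoss_zero_eq_zero_iff
    (hbdd : Bornology.IsBounded ((fun x => p.f x s) '' p.feasible φ s))
    (hx : x ∈ p.feasible φ s) : p.suboptLoss 0 x θ φ s = 0 ↔ x ∈ p.FOP θ φ s := by
  have hbddAbove : BddAbove ((fun x' => inner ℝ θ (p.f x' s)) '' p.feasible φ s) := by
    have := ((innerSL ℝ θ).lipschitz.isBounded_image hbdd).bddAbove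
    rwa [Set.image_image] at this
  have hloss : p.suboptLoss 0 x θ φ s = 0 ↔
      sSup ((fun x' => inner ℝ θ (p.f x' s)) '' p.feasible φ s) ≤ inner ℝ θ (p.f x s) := by
    simp [suboptLoss]
  rw [hloss, csSup_le_iff hbddAbove ⟨_, x, hx, rfl⟩, Set.forall_mem_image]
  exact (and_iff_right hx).symm

theorem empiricalLoss_nonneg : 0 ≤ p.empiricalLoss data xhat φ θ :=
  mul_nonneg (by positivity) (Finset.sum_nonneg fun _ _ => suboptLoss_zero_nonneg)

theorem empiricalLoss_eq_zero_iff :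
    p.empiricalLoss data xhat φ θ = 0 ↔ ∀ n, p.suboptLoss 0 (xhat (data n)) θ φ (data n) = 0 := by
  rcases eq_or_ne N 0 with rfl | hN
  · simp [empiricalLoss]
  · simp [empiricalLoss, hN, Finset.sum_eq_zero_iff_of_nonneg, suboptLoss_zero_nonneg]

theorem IsPSGDRun.mem_simplex {K : ℕ} {θ : ℕ → EuclideanSpace ℝ (Fin D)}
    (hrun : p.IsPSGDRun data xhat xstar K θ) {i : ℕ} (hi : 1 ≤ i) (hiK : i ≤ K) :
    θ i ∈ simplex D := by
  induction i, hi using Nat.le_induction with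
  | base => exact hrun.1
  | succ i hi _ => exact (hrun.2 i hi hiK).1

theorem IsPSGDRun.exists_meanGap_eq_zero {K : ℕ} {θ : ℕ → EuclideanSpace ℝ (Fin D)}
    (hrun : p.IsPSGDRun data xhat xstar K θ) (hηmem : η ∈ simplex D)
    (hη : p.IsStrictlyOptimal η φ xhat)
    (hstar : p.IsVertexSolver Y φ xstar) (hY : ∀ s, (Y φ s).Finite)
    (hbdd : ∀ s, Bornology.IsBounded ((fun x => p.f x s) '' p.feasible φ s)) (hK1 : 1 ≤ K)
    (hK : iterationBound (p.gammaConst data xhat xstar φ η) (‖θ 1 - η‖ ^ 2) ≤ K) :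
    ∃ i, 1 ≤ i ∧ i ≤ K ∧ p.meanGap data xhat xstar (θ i) = 0 := by
  by_contra! hne
  have hγ := gammaConst_pos hη hstar hY hbdd hrun.1 (hne 1 le_rfl hK1)
  refine (lt_of_iterationBound_le hγ hK1 hK).not_ge ?_
  exact two_mul_sqrt_le_of_normalized_descent convex_simplex hηmem hγ.le hK1
    (fun i hi hiK => (hrun.2 i hi hiK).1) (fun i hi hiK => (hrun.2 i hi hiK).2) hne
    fun i hi hiK => gammaConst_mul_norm_meanGap_le hη hstar hY hbdd (hrun.mem_simplex hi hiK)
      (hne i hi hiK)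

theorem IsBestIterate.mem_FOP {K : ℕ} {θ : ℕ → EuclideanSpace ℝ (Fin D)}
    {θbest : EuclideanSpace ℝ (Fin D)} (hbest : p.IsBestIterate data xhat φ K θ θbest)
    (hbdd : ∀ s, Bornology.IsBounded ((fun x => p.f x s) '' p.feasible φ s))
    (hxhat : ∀ s, xhat s ∈ p.feasible φ s) {i : ℕ} (hi : 1 ≤ i) (hiK : i ≤ K)
    (hopt : ∀ n, xhat (data n) ∈ p.FOP (θ i) φ (data n)) (n : Fin N) :
    xhat (data n) ∈ p.FOP θbest φ (data n) := by
  obtain ⟨-, -, -, -, hmin⟩ := hbest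
  have hzero : p.empiricalLoss data xhat φ (θ i) = 0 :=
    empiricalLoss_eq_zero_iff.2 fun n =>
      (suboptLoss_zero_eq_zero_iff (hbdd _) (hxhat _)).2 (hopt n)
  have hbest0 := ((hmin i hi hiK).trans_eq hzero).antisymm empiricalLoss_nonneg
  exact (suboptLoss_zero_eq_zero_iff (hbdd _) (hxhat _)).1 (empiricalLoss_eq_zero_iff.1 hbest0 n)

end Forward

end InverseMILP

open InverseMILP InverseMILP.Forward in
theorem mainTheorem1_general {k D d J N : ℕ} {S : Type*} [MeasurableSpace S]
    (p : Forward k D d J S)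
    (hg : ∀ x ∈ p.X, ∀ s, MonotoneOn (fun φ => p.g x φ s) p.Φ)
    (φtrue : Fin d → ℝ) (hφtrue : φtrue ∈ p.Φ)
    (hA : ∀ s, IsPolytopeUnion ((fun x => p.f x s) '' p.feasible φtrue s))
    (Y : (Fin d → ℝ) → S → Set (EuclideanSpace ℝ (Fin D)))
    (hY : ∀ φ ∈ p.Φ, ∀ s, (Y φ s).Finite)
    (P : Measure S) (data : Fin N → S) (hdata : Function.Surjective data) :
    ∀ᵐ θtrue ∂(simplexMeasure D),
      ∀ xhat : S → EuclideanSpace ℝ (Fin k), (∀ s, xhat s ∈ p.FOP θtrue φtrue s) →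
      ∀ φsup : Fin d → ℝ, p.IsPhiSup xhat φsup →
      ∀ xstar : EuclideanSpace ℝ (Fin D) → S → EuclideanSpace ℝ (Fin k),
        p.IsVertexSolver Y φsup xstar →
      ∀ (K : ℕ) (θ : ℕ → EuclideanSpace ℝ (Fin D)), p.IsPSGDRun data xhat xstar K θ →
        iterationBound (p.gammaConst data xhat xstar φsup θtrue) (‖θ 1 - θtrue‖ ^ 2) ≤ K →
      ∀ θsup : EuclideanSpace ℝ (Fin D), p.IsBestIterate data xhat φsup K θ θsup →
        p.IsTwoStageOutput P xhat 0 θsup φsup ∧ ∀ s, xhat s ∈ p.FOP θsup φsup s := by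
  have : Finite S := Finite.of_surjective data hdata
  have hmem : ∀ᵐ θtrue ∂(simplexMeasure D), θtrue ∈ simplex D :=
    ae_restrict_mem isClosed_simplex.measurableSet
  filter_upwards [hmem, ae_isStrictlyOptimal hA]
    with θtrue hθtrue hstrict xhat hxhat φsup hsup xstar hstar K θ hrun hK θsup hbest
  have hsub := hsup.feasible_subset hg hφtrue fun s => (hxhat s).1
  have hfeas : ∀ s, xhat s ∈ p.feasible φsup s := fun s => ⟨(hxhat s).1.1, hsup.1.2 s⟩
  have hopt : p.IsStrictlyOptimal θtrue φsup xhat := (hstrict xhat hxhat).anti hsub hfeas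
  have hbdd : ∀ s, Bornology.IsBounded ((fun x => p.f x s) '' p.feasible φsup s) := fun s =>
    (hA s).isBounded.subset (Set.image_mono (hsub s))
  have ⟨j, hj, hjK, hbest_eq, _⟩ := hbest
  obtain ⟨i, hi, hiK, hmean⟩ := hrun.exists_meanGap_eq_zero hθtrue hopt hstar
    (hY φsup hsup.1.1) hbdd (hj.trans hjK) hK
  have hsol := hstar (θ i) (hrun.mem_simplex hi hiK)
  have hFOP : ∀ s, xhat s ∈ p.FOP θsup φsup s := hdata.forall.2 <|
    hbest.mem_FOP hbdd hfeas hi hiK fun n => mem_FOP_of_gap_eq_zero (hsol _).1 (hfeas _) <|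
      hopt.gap_eq_zero_of_meanGap_eq_zero (fun s => (hsol s).1.1) hmean n
  have hloss : ∀ s, p.suboptLoss 0 (xhat s) θsup φsup s = 0 := fun s =>
    (suboptLoss_zero_eq_zero_iff (hbdd s) (hfeas s)).2 (hFOP s)
  exact ⟨⟨hsup, hbest_eq ▸ hrun.mem_simplex hj hjK, by simp [hloss]⟩, hFOP⟩

theorem mainTheorem1 {k D d J N : ℕ} {S : Type*} [Finite S] [Nonempty S]
    [MeasurableSpace S] [DiscreteMeasurableSpace S]
    (p : InverseMILP.Forward k D d J S)
    (hpoly : p.Polyhedral) (hlat : p.LatticeConstraints)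
    (Y : (Fin d → ℝ) → S → Set (EuclideanSpace ℝ (Fin D)))
    (hY : ∀ φ ∈ p.Φ, ∀ s,
      InverseMILP.IsVertexSet ((fun x => p.f x s) '' p.feasible φ s) (Y φ s))
    (P : MeasureTheory.Measure S) [MeasureTheory.IsProbabilityMeasure P]
    (data : Fin N → S) (hdata : Function.Surjective data)
    (φtrue : Fin d → ℝ) (hφtrue : φtrue ∈ p.Φ) :
    ∀ᵐ θtrue ∂(InverseMILP.simplexMeasure D),
      ∀ xhat : S → EuclideanSpace ℝ (Fin k),
        (∀ s, xhat s ∈ p.FOP θtrue φtrue s) →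
      ∀ φsup : Fin d → ℝ, p.IsPhiSup xhat φsup →
      ∀ xstar : EuclideanSpace ℝ (Fin D) → S → EuclideanSpace ℝ (Fin k),
        p.IsVertexSolver Y φsup xstar →
      ∀ (K : ℕ) (θ : ℕ → EuclideanSpace ℝ (Fin D)),
        p.IsPSGDRun data xhat xstar K θ →
        InverseMILP.iterationBound (p.gammaConst data xhat xstar φsup θtrue)
          (‖θ 1 - θtrue‖ ^ 2) ≤ K →
      ∀ θsup : EuclideanSpace ℝ (Fin D),
        p.IsBestIterate data xhat φsup K θ θsup →
        p.IsTwoStageOutput P xhat 0 θsup φsup ∧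
        ∀ s, xhat s ∈ p.FOP θsup φsup s :=
  mainTheorem1_general p (fun x hx s => (hlat.hom x hx s).monotoneOn) φtrue hφtrue
    (fun s => (hY φtrue hφtrue s).isPolytopeUnion) Y (fun φ hφ s => (hY φ hφ s).finite) P data
    hdata
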